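/- Let $n\ge 1$, let $E_1,\dots,E_n,F$ be Banach spaces over $\mathbb K=\mathbb R$ or $\mathbb C$, and let $q$ be a real number with $q>2$. Suppose that each $E_k$ has cotype $q$, i.e. there is $C_k\ge 0$ such that $$\Big(\sum_{i=1}^m\|x_i\|^q\Big)^{1/q}\le C_k\Big(\frac1{2^m}\sum_{\varepsilon\in\{-1,1\}^m}\Big\|\sum_{i=1}^m\varepsilon_i x_i\Big\|^2\Big)^{1/2}$$ for all $m$ and all $x_1,\dots,x_m\in E_k$. For $1\le p<\infty$, let $\Pi_p^n(E_1,\dots,E_n;F)$ be the linear space of all multiple $p$-summing (that is, multiple $(p;p,\dots,p)$-summing) maps: the continuous $n$-linear maps $A:E_1\times\cdots\times E_n\to F$ for which there is $C\ge 0$ such that $$\Big(\sum_{j_1=1}^{m_1}\cdots\sum_{j_n=1}^{m_n}\big\|A(x^{(1)}_{j_1},\dots,x^{(n)}_{j_n})\big\|^p\Big)^{1/p}\le C\prod_{k=1}^n\ \sup_{\varphi\in E_k',\ \|\varphi\|\le 1}\Big(\sum_{j=1}^{m_k}|\varphi(x^{(k)}_j)|^p\Big)^{1/p}$$ for all $m_1,\dots,m_n\in\mathbb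 N$ and all $x^{(k)}_j\in E_k$. Then $$\Pi_s^n(E_1,\dots,E_n;F)=\Pi_p^n(E_1,\dots,E_n;F)\qquad\text{for all real } s,p \text{ with } 1\le s\le p<\frac{q}{q-1}.$$ -/

import Mathlib

/-- A normed space `E` has (Rademacher) cotype `q` if, for some `C ≥ 0`, every finite family satisfies
`(∑ ‖x k‖ ^ q) ^ (1 / q) ≤ C * (𝔼 ‖∑ ε k • x k‖ ^ 2) ^ (1 / 2)`, where `ε` is uniformly distributed
over all choices of signs `ε k = ±1` (elements of `ℤˣ`). -/
def HasCotype (E : Type*) [NormedAddCommGroup E] (q : ℝ) : Prop :=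
  ∃ C : ℝ, 0 ≤ C ∧ ∀ (m : ℕ) (x : Fin m → E),
    (∑ k, ‖x k‖ ^ q) ^ (1 / q) ≤
      C * Real.sqrt ((∑ ε : Fin m → ℤˣ, ‖∑ k, ((ε k : ℤˣ) : ℤ) • x k‖ ^ 2) / 2 ^ m)

/-- The weak `ℓ_p` norm of a finite family:
`sup {(∑ |φ (x j)| ^ p) ^ (1 / p) : φ ∈ E', ‖φ‖ ≤ 1}`. -/
noncomputable def weakLpNorm (𝕜 : Type*) [RCLike 𝕜] {E : Type*} [NormedAddCommGroup E]
    [NormedSpace 𝕜 E] (p : ℝ) {m : ℕ} (x : Fin m → E) : ℝ :=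
  ⨆ φ : {φ : StrongDual 𝕜 E // ‖φ‖ ≤ 1}, (∑ j, ‖φ.1 (x j)‖ ^ p) ^ (1 / p)

/-- The supremum that defines the weak norm is a genuine one. -/
theorem weakLpNorm_bddAbove (𝕜 : Type*) [RCLike 𝕜] {E : Type*} [NormedAddCommGroup E]
    [NormedSpace 𝕜 E] {p : ℝ} (hp : 0 ≤ p) {m : ℕ} (x : Fin m → E) :
    BddAbove (Set.range fun φ : {φ : StrongDual 𝕜 E // ‖φ‖ ≤ 1} =>
      (∑ j, ‖φ.1 (x j)‖ ^ p) ^ (1 / p)) := by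
  refine ⟨(∑ j, ‖x j‖ ^ p) ^ (1 / p), ?_⟩
  rintro _ ⟨φ, rfl⟩
  have h : ∀ j, ‖φ.1 (x j)‖ ≤ ‖x j‖ := fun j => by
    simpa using φ.1.le_of_opNorm_le φ.2 (x j)
  dsimp only
  gcongr with j
  exact h j

/-- `A` is multiple `(q; p 1, …, p n)`-summing. -/
def IsMultipleSumming {𝕜 : Type*} [RCLike 𝕜] {n : ℕ} {E : Fin n → Type*} {F : Type*}
    [∀ k, NormedAddCommGroup (E k)] [∀ k, NormedSpace 𝕜 (E k)]
    [NormedAddCommGroup F] [NormedSpace 𝕜 F] (q : ℝ) (p : Fin n → ℝ)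
    (A : ContinuousMultilinearMap 𝕜 E F) : Prop :=
  ∃ C : ℝ, 0 ≤ C ∧ ∀ (m : Fin n → ℕ) (x : ∀ k, Fin (m k) → E k),
    (∑ j : (∀ k, Fin (m k)), ‖A (fun k => x k (j k))‖ ^ q) ^ (1 / q) ≤
      C * ∏ k, weakLpNorm 𝕜 (p k) (x k)

/-- The space `Π_p^n(E_1, …, E_n; F)` of multiple `(p; p, …, p)`-summing maps (`1 ≤ p < ∞`), as a
linear subspace of the space of all continuous `n`-linear maps. -/
def multipleSumming (𝕜 : Type*) [RCLike 𝕜] {n : ℕ} (E : Fin n → Type*) (F : Type*)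
    [∀ k, NormedAddCommGroup (E k)] [∀ k, NormedSpace 𝕜 (E k)]
    [NormedAddCommGroup F] [NormedSpace 𝕜 F] (p : ℝ) (hp : 1 ≤ p) :
    Submodule 𝕜 (ContinuousMultilinearMap 𝕜 E F) where
  carrier := {A | IsMultipleSumming p (fun _ => p) A}
  zero_mem' := by
    have h0 : p ≠ 0 := by linarith
    refine ⟨0, le_rfl, fun m x => ?_⟩
    simp [Real.zero_rpow h0, Real.zero_rpow (inv_ne_zero h0)]
  add_mem' := by
    rintro A B ⟨C, hC, hA⟩ ⟨D, hD, hB⟩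
    refine ⟨C + D, add_nonneg hC hD, fun m x => ?_⟩
    rw [add_mul]
    refine le_trans ?_ (add_le_add (hA m x) (hB m x))
    refine le_trans ?_ (Real.Lp_add_le_of_nonneg Finset.univ hp
      (fun i _ => norm_nonneg (A fun k => x k (i k)))
      (fun i _ => norm_nonneg (B fun k => x k (i k))))
    gcongr with j
    exact norm_add_le _ _
  smul_mem' := by
    rintro c A ⟨C, hC, hA⟩
    have h0 : p ≠ 0 := by linarith
    refine ⟨‖c‖ * C, by positivity, fun m x => ?_⟩
    have h : (∑ j : (∀ k, Fin (m k)), ‖(c • A) (fun k => x k (j k))‖ ^ p) ^ (1 / p) =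
        ‖c‖ * (∑ j : (∀ k, Fin (m k)), ‖A (fun k => x k (j k))‖ ^ p) ^ (1 / p) := by
      simp only [_root_.smul_apply, norm_smul]
      simp_rw [Real.mul_rpow (norm_nonneg c) (norm_nonneg _)]
      rw [← Finset.mul_sum, Real.mul_rpow (by positivity) (by positivity),
        ← Real.rpow_mul (norm_nonneg c), mul_one_div_cancel h0, Real.rpow_one]
    rw [h, mul_assoc]
    exact mul_le_mul_of_nonneg_left (hA m x) (norm_nonneg c)

/-! Both spaces coincide with the one for exponent 1 (`isMultipleSumming_iff_one`).

From 1 to p, for 1 < p < 2, no cotype is needed. Random signs times heavy-tailed values with tail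
t^(-p) imitate p-stable variables and embed ℓ_p^m into some ℓ_1^M with constants independent of m;
the lower bound persists for coefficients in F (`exists_embedding_l1`) and, by Minkowski, for tensor
products of the embeddings (`rpow_sum_norm_le_sum_norm_prod_smul`). Such embeddings turn weakly
p-summable families into weakly 1-summable ones.

From p to 1, cotype q factors a weakly 1-summable family as x_j = α_j y_j, with α in ℓ_{p*} and y
weakly p-summable (`exists_smul_weakly_summable`); multilinearity and Hölder finish. The
factorisation comes from a weight μ of bounded mass such that every signed sum over B has norm at
most (q μ(B))^(1/q) (`exists_weight_of_cotype`). It makes |φ(x_j)|/μ_j uniformly bounded in weak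
L_{q/(q-1)}(μ), hence in L_p(μ) for every p < q/(q-1). The assumption q > 2 guarantees q/(q-1) < 2,
so both directions apply. -/

/-- Multiplication by a sign preserves the norm. -/
theorem norm_units_int_smul {E : Type*} [NormedAddCommGroup E] (ε : ℤˣ) (x : E) :
    ‖((ε : ℤˣ) : ℤ) • x‖ = ‖x‖ := by
  rcases Int.units_eq_one_or ε with h | h <;> simp [h]

/-! ### Dyadic summation and an elementary inequality -/

/-- A dyadic layer-cake estimate: on each block where c lies in (2^k, 2^(k+1)], g is at most its
value at the right endpoint, and the block has mass at most the tail bound `v k`. Points with c = 0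
contribute nothing. -/
theorem sum_mul_le_tsum_zpow {ι : Type*} [Fintype ι] (μ c : ι → ℝ) (hμ : ∀ j, 0 ≤ μ j)
    (hc : ∀ j, 0 ≤ c j) (g : ℝ → ℝ) (hg0 : g 0 = 0) (hg : MonotoneOn g (Set.Ici 0))
    (v : ℤ → ℝ) (hv : ∀ k : ℤ, ∑ j with (2 : ℝ) ^ k < c j, μ j ≤ v k)
    (hs : Summable fun k : ℤ => g (2 ^ (k + 1)) * v k) :
    ∑ j, μ j * g (c j) ≤ ∑' k : ℤ, g (2 ^ (k + 1)) * v k := by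
  classical
  have hgn : ∀ t, 0 ≤ t → 0 ≤ g t := fun t ht => by
    simpa [hg0] using hg (Set.mem_Ici.2 le_rfl) (Set.mem_Ici.2 ht) ht
  have hvn : ∀ k, 0 ≤ v k := fun k => (Finset.sum_nonneg fun j _ => hμ j).trans (hv k)
  have hk : ∀ j, ∃ k : ℤ, 0 < c j → (2 : ℝ) ^ k < c j ∧ c j ≤ 2 ^ (k + 1) := fun j => by
    by_cases h : 0 < c j
    · obtain ⟨k, hk⟩ := exists_mem_Ioc_zpow h (one_lt_two (α := ℝ))
      exact ⟨k, fun _ => hk⟩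
    · exact ⟨0, fun h' => absurd h' h⟩
  choose K hK using hk
  set P : Finset ι := Finset.univ.filter fun j => 0 < c j
  have h1 : ∑ j, μ j * g (c j) = ∑ j ∈ P, μ j * g (c j) := by
    refine (Finset.sum_subset (Finset.subset_univ P) fun j _ hj => ?_).symm
    have : c j = 0 := le_antisymm (by simpa [P] using hj) (hc j)
    rw [this, hg0, mul_zero]
  rw [h1, ← Finset.sum_fiberwise_of_maps_to (g := K) (t := P.image K)
    fun j hj => Finset.mem_image_of_mem _ hj]
  refine le_trans (Finset.sum_le_sum fun k _ => ?_)
    (hs.sum_le_tsum (P.image K) fun k _ => mul_nonneg (hgn _ (by positivity)) (hvn k))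
  calc ∑ j ∈ P with K j = k, μ j * g (c j)
      ≤ ∑ j ∈ P with K j = k, μ j * g (2 ^ (k + 1)) := by
        refine Finset.sum_le_sum fun j hj => mul_le_mul_of_nonneg_left ?_ (hμ j)
        simp only [Finset.mem_filter, P, Finset.mem_univ, true_and] at hj
        have := (hK j hj.1).2
        rw [hj.2] at this
        exact hg (hc j) (Set.mem_Ici.2 (by positivity)) this
    _ = g (2 ^ (k + 1)) * ∑ j ∈ P with K j = k, μ j := by rw [← Finset.sum_mul, mul_comm]
    _ ≤ _ := by
        refine mul_le_mul_of_nonneg_left (le_trans ?_ (hv k)) (hgn _ (by positivity))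
        refine Finset.sum_le_sum_of_subset_of_nonneg (fun j hj => ?_) fun j _ _ => hμ j
        simp only [Finset.mem_filter, P, Finset.mem_univ, true_and] at hj ⊢
        have := (hK j hj.1).1
        rwa [hj.2] at this

theorem summable_zpow_two_rpow {a b : ℝ} (ha : a < 0) (hb : 0 < b) :
    Summable fun k : ℤ => if 0 ≤ k then ((2 : ℝ) ^ k) ^ a else ((2 : ℝ) ^ k) ^ b := by
  have key : ∀ t : ℝ, t < 0 → Summable fun n : ℕ => ((2 : ℝ) ^ n) ^ t := fun t ht => by
    have : (fun n : ℕ => ((2 : ℝ) ^ n) ^ t) = fun n : ℕ => ((2 : ℝ) ^ t) ^ n := by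
      funext n
      rw [← Real.rpow_natCast, ← Real.rpow_natCast, ← Real.rpow_mul zero_le_two,
        ← Real.rpow_mul zero_le_two, mul_comm]
    rw [this]
    exact summable_geometric_of_lt_one (by positivity)
      (Real.rpow_lt_one_of_one_lt_of_neg one_lt_two ht)
  refine Summable.of_nat_of_neg_add_one ?_ ?_
  · simpa using key a ha
  · have := (summable_nat_add_iff 1).2 (key (-b) (by linarith))
    refine this.congr fun n => ?_
    rw [if_neg (by omega), zpow_neg, Real.inv_rpow (by positivity), Real.rpow_neg (by positivity)]
    norm_cast

/-- The graph of the convex function t ↦ t^q lies above its tangent at a; this is Bernoulli's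
inequality for (b - a)/a. -/
theorem Real.rpow_sub_rpow_le {q a b : ℝ} (hq : 1 ≤ q) (ha : 0 ≤ a) (hb : 0 ≤ b) :
    a ^ q - b ^ q ≤ q * (a ^ (q - 1) * (a - b)) := by
  rcases ha.eq_or_lt with rfl | ha
  · rw [Real.zero_rpow (by linarith)]
    rcases hq.eq_or_lt with rfl | hq
    · simp
    · rw [Real.zero_rpow (by linarith)]
      simp only [zero_mul, mul_zero]
      linarith [Real.rpow_nonneg hb q]
  · have h := one_add_mul_self_le_rpow_one_add (s := (b - a) / a) (p := q)
      (by rw [le_div_iff₀ ha]; linarith) hq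
    have e : 1 + (b - a) / a = b / a := by field_simp; ring
    rw [e, Real.div_rpow hb ha.le, le_div_iff₀ (by positivity)] at h
    have e2 : a ^ q = a ^ (q - 1) * a := by
      rw [← Real.rpow_add_one ha.ne']; ring_nf
    have e3 : (1 + q * ((b - a) / a)) * a ^ q = a ^ q + q * (a ^ (q - 1) * (b - a)) := by
      rw [e2]; field_simp
    rw [e3] at h
    linarith

/-! ### Maximal signed sums and dominating weights -/

/-- The largest norm of a signed sum of the vectors `x j`, `j ∈ B`. -/
noncomputable def signNorm {ι E : Type*} [Fintype ι] [DecidableEq ι] [NormedAddCommGroup E] (x : ι → E)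
    (B : Finset ι) : ℝ :=
  Finset.univ.sup' Finset.univ_nonempty fun ε : ι → ℤˣ => ‖∑ j ∈ B, ((ε j : ℤˣ) : ℤ) • x j‖

section signNorm

variable {ι E : Type*} [Fintype ι] [DecidableEq ι] [NormedAddCommGroup E] (x : ι → E) (B : Finset ι)

theorem norm_sum_le_signNorm (ε : ι → ℤˣ) :
    ‖∑ j ∈ B, ((ε j : ℤˣ) : ℤ) • x j‖ ≤ signNorm x B :=
  Finset.le_sup' (fun ε : ι → ℤˣ => ‖∑ j ∈ B, ((ε j : ℤˣ) : ℤ) • x j‖) (Finset.mem_univ ε)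

theorem exists_signNorm_eq : ∃ ε : ι → ℤˣ, signNorm x B = ‖∑ j ∈ B, ((ε j : ℤˣ) : ℤ) • x j‖ := by
  obtain ⟨ε, -, h⟩ := Finset.exists_mem_eq_sup' Finset.univ_nonempty
    fun ε : ι → ℤˣ => ‖∑ j ∈ B, ((ε j : ℤˣ) : ℤ) • x j‖
  exact ⟨ε, h⟩

theorem signNorm_nonneg : 0 ≤ signNorm x B :=
  (norm_nonneg _).trans (norm_sum_le_signNorm x B 1)

theorem signNorm_empty : signNorm x ∅ = 0 := by
  obtain ⟨ε, h⟩ := exists_signNorm_eq x ∅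
  simpa using h

theorem norm_le_signNorm_singleton (j : ι) : ‖x j‖ ≤ signNorm x {j} := by
  simpa using norm_sum_le_signNorm x {j} 1

variable {𝕜 : Type*} [RCLike 𝕜] [NormedSpace 𝕜 E]

theorem sum_abs_re_le_signNorm (φ : StrongDual 𝕜 E) (hφ : ‖φ‖ ≤ 1) :
    ∑ j ∈ B, |RCLike.re (φ (x j))| ≤ signNorm x B := by
  let ε : ι → ℤˣ := fun j => if 0 ≤ RCLike.re (φ (x j)) then 1 else -1
  refine le_trans ?_ (norm_sum_le_signNorm x B ε)
  refine le_trans ?_ ((φ.le_of_opNorm_le hφ _).trans_eq (one_mul _))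
  refine le_trans (le_of_eq ?_) (RCLike.re_le_norm _)
  rw [map_sum, map_sum]
  refine Finset.sum_congr rfl fun j _ => ?_
  by_cases h : 0 ≤ RCLike.re (φ (x j))
  · simp [ε, h, abs_of_nonneg]
  · simp [ε, h, abs_of_neg (not_le.1 h)]

/-- Signs can be aligned with the real parts of φ(x_j); the imaginary parts are, up to sign, the
real parts for iφ. Hence the factor 2. -/
theorem sum_norm_le_signNorm (φ : StrongDual 𝕜 E) (hφ : ‖φ‖ ≤ 1) :
    ∑ j ∈ B, ‖φ (x j)‖ ≤ 2 * signNorm x B := by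
  have h1 := sum_abs_re_le_signNorm x B φ hφ
  have h2 := sum_abs_re_le_signNorm x B ((RCLike.I : 𝕜) • φ) (by
    rw [norm_smul]
    refine mul_le_one₀ ?_ (norm_nonneg _) hφ
    rcases RCLike.I_mul_I_ax (K := 𝕜) with h | h
    · simp [h]
    · have : ‖(RCLike.I : 𝕜)‖ * ‖(RCLike.I : 𝕜)‖ = 1 := by rw [← norm_mul, h]; simp
      nlinarith [norm_nonneg (RCLike.I : 𝕜)])
  refine (Finset.sum_le_sum fun j _ => ?_).trans
    ((Finset.sum_add_distrib).le.trans ((add_le_add h1 h2).trans_eq (two_mul _).symm))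
  have : RCLike.re (((RCLike.I : 𝕜) • φ) (x j)) = - RCLike.im (φ (x j)) := by
    simp
  rw [this, abs_neg]
  refine abs_le_of_sq_le_sq (a := ‖φ (x j)‖) ?_ (by positivity) |> (le_abs_self _).trans
  have := RCLike.norm_sq_eq_def (z := φ (x j))
  nlinarith [sq_abs (RCLike.re (φ (x j))), sq_abs (RCLike.im (φ (x j))),
    mul_nonneg (abs_nonneg (RCLike.re (φ (x j)))) (abs_nonneg (RCLike.im (φ (x j))))]

theorem signNorm_univ_le_of_sum_norm_le {W : ℝ}
    (h : ∀ φ : StrongDual 𝕜 E, ‖φ‖ ≤ 1 → ∑ j, ‖φ (x j)‖ ≤ W) : signNorm x Finset.univ ≤ W := by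
  obtain ⟨ε, hε⟩ := exists_signNorm_eq x Finset.univ
  obtain ⟨φ, hφ, h'⟩ := exists_dual_vector'' 𝕜 (∑ j, ((ε j : ℤˣ) : ℤ) • x j)
  rw [hε]
  have h2 : ‖φ (∑ j, ((ε j : ℤˣ) : ℤ) • x j)‖ = ‖∑ j, ((ε j : ℤˣ) : ℤ) • x j‖ := by
    rw [h']; simp
  rw [← h2, map_sum]
  refine (norm_sum_le _ _).trans ((Finset.sum_le_sum fun j _ => ?_).trans (h φ hφ))
  rw [map_zsmul, norm_units_int_smul]

/-- A norming functional of a maximal signed sum, read as a weight on `B`. -/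
theorem exists_weight_signNorm (𝕜 : Type*) [RCLike 𝕜] [NormedSpace 𝕜 E] :
    ∃ ν : ι → ℝ, (∀ j ∈ B, 0 ≤ ν j) ∧ ∑ j ∈ B, ν j = signNorm x B ∧
      ∀ D : Finset ι, signNorm x B - ∑ j ∈ B ∩ D, ν j ≤ signNorm x (B \ D) := by
  obtain ⟨ε, hε⟩ := exists_signNorm_eq x B
  obtain ⟨φ, hφ, h'⟩ := exists_dual_vector'' 𝕜 (∑ j ∈ B, ((ε j : ℤˣ) : ℤ) • x j)
  have key : ∀ (δ : ι → ℤˣ) (D : Finset ι),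
      ∑ j ∈ D, RCLike.re (φ (((δ j : ℤˣ) : ℤ) • x j)) ≤ signNorm x D := fun δ D => by
    rw [← map_sum, ← map_sum]
    refine (RCLike.re_le_norm _).trans (le_trans ?_ (norm_sum_le_signNorm x D δ))
    exact (φ.le_of_opNorm_le hφ _).trans_eq (one_mul _)
  have htot : ∑ j ∈ B, RCLike.re (φ (((ε j : ℤˣ) : ℤ) • x j)) = signNorm x B := by
    rw [← map_sum, ← map_sum, h', hε]; simp
  refine ⟨fun j => RCLike.re (φ (((ε j : ℤˣ) : ℤ) • x j)), fun i hi => ?_, htot, fun D => ?_⟩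
  -- Flipping one sign cannot increase the maximal sum, so each term contributes nonnegatively.
  · have h1 := key (Function.update ε i (-ε i)) B
    rw [← Finset.add_sum_erase _ _ hi] at h1 htot
    rw [Finset.sum_congr rfl (g := fun j => RCLike.re (φ (((ε j : ℤˣ) : ℤ) • x j)))
      fun j hj => by rw [Function.update_of_ne (Finset.ne_of_mem_erase hj)]] at h1
    simp only [Function.update_self, Units.val_neg, neg_smul, map_neg] at h1
    linarith
  · have h1 := key ε (B \ D)
    rw [← htot, ← Finset.sum_sdiff (Finset.inter_subset_left (s₁ := B) (s₂ := D)),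
      Finset.sdiff_inter_self_left]
    linarith

end signNorm

/-- The inequality behind the factorisation of `(q, 1)`-summing operators on `C(K)`: a partition that
maximises `∑ ‖·‖ ^ q` yields a dominating weight. -/
theorem exists_weight_of_cotype (𝕜 : Type*) [RCLike 𝕜] {E : Type*} [NormedAddCommGroup E]
    [NormedSpace 𝕜 E] {q C : ℝ} (hq : 1 ≤ q) (hC : 0 ≤ C)
    (hE : ∀ (m : ℕ) (x : Fin m → E), (∑ k, ‖x k‖ ^ q) ^ (1 / q) ≤
      C * Real.sqrt ((∑ ε : Fin m → ℤˣ, ‖∑ k, ((ε k : ℤˣ) : ℤ) • x k‖ ^ 2) / 2 ^ m))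
    {m : ℕ} (x : Fin m → E) :
    ∃ μ : Fin m → ℝ, (∀ j, 0 ≤ μ j) ∧ ∑ j, μ j ≤ (C * signNorm x Finset.univ) ^ q ∧
      ∀ B : Finset (Fin m), signNorm x B ^ q ≤ q * ∑ j ∈ B, μ j := by
  classical
  -- Labelled partitions of the m indices into m + 1 classes: one label more than there are points,
  -- so that some class is always empty.
  let A : (Fin m → Fin (m + 1)) → Fin (m + 1) → Finset (Fin m) :=
    fun π i => Finset.univ.filter fun j => π j = i
  obtain ⟨π, hπ⟩ := Finite.exists_max fun π : Fin m → Fin (m + 1) => ∑ i, signNorm x (A π i) ^ q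
  choose ν hν0 hν1 hν using fun i => exists_weight_signNorm x (A π i) 𝕜
  have hq0 : q ≠ 0 := by linarith
  -- Up to the factor q, this is the first-order change of ∑ ‖·‖^q when j is removed from its class.
  let μ : Fin m → ℝ := fun j => signNorm x (A π (π j)) ^ (q - 1) * ν (π j) j
  have hμsum : ∀ B : Finset (Fin m),
      ∑ j ∈ B, μ j = ∑ i, signNorm x (A π i) ^ (q - 1) * ∑ j ∈ A π i ∩ B, ν i j := fun B => by
    rw [← Finset.sum_fiberwise_of_maps_to (g := π) (t := Finset.univ) fun j _ => Finset.mem_univ _]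
    refine Finset.sum_congr rfl fun i _ => ?_
    rw [Finset.mul_sum]
    refine Finset.sum_congr ?_ fun j hj => ?_
    · ext j; simp [A, and_comm]
    · simp only [A, Finset.mem_inter, Finset.mem_filter, Finset.mem_univ, true_and] at hj
      simp only [μ, hj.1]
  have htot : ∑ i, signNorm x (A π i) ^ q ≤ (C * signNorm x Finset.univ) ^ q := by
    choose ε hε using fun i => exists_signNorm_eq x (A π i)
    -- Cotype is applied to one extremal signed sum per class; any signed combination of these is
    -- again a signed sum of the x_j.
    have h1 := hE (m + 1) fun i => ∑ j ∈ A π i, ((ε i j : ℤˣ) : ℤ) • x j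
    simp only [← hε] at h1
    have h2 : ∀ δ : Fin (m + 1) → ℤˣ,
        ‖∑ i, ((δ i : ℤˣ) : ℤ) • ∑ j ∈ A π i, ((ε i j : ℤˣ) : ℤ) • x j‖ ≤
          signNorm x Finset.univ := fun δ => by
      refine le_trans (le_of_eq ?_)
        (norm_sum_le_signNorm x Finset.univ fun j => δ (π j) * ε (π j) j)
      rw [← Finset.sum_fiberwise_of_maps_to (s := Finset.univ) (g := π) (t := Finset.univ)
        fun j _ => Finset.mem_univ _]
      congr 1
      refine Finset.sum_congr rfl fun i _ => ?_
      rw [Finset.smul_sum]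
      refine Finset.sum_congr rfl fun j hj => ?_
      simp only [Finset.mem_filter, Finset.mem_univ, true_and] at hj
      rw [hj, Units.val_mul, mul_smul]
    have h3 : Real.sqrt ((∑ δ : Fin (m + 1) → ℤˣ,
        ‖∑ i, ((δ i : ℤˣ) : ℤ) • ∑ j ∈ A π i, ((ε i j : ℤˣ) : ℤ) • x j‖ ^ 2) / 2 ^ (m + 1)) ≤
          signNorm x Finset.univ := by
      refine Real.sqrt_le_iff.2 ⟨signNorm_nonneg _ _, ?_⟩
      rw [div_le_iff₀ (by positivity)]
      refine (Finset.sum_le_sum fun δ _ => pow_le_pow_left₀ (norm_nonneg _) (h2 δ) 2).trans ?_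
      simp [mul_comm]
    have h4 := Real.rpow_le_rpow (Real.rpow_nonneg (Finset.sum_nonneg fun i _ =>
      Real.rpow_nonneg (signNorm_nonneg _ _) _) _)
      (h1.trans (mul_le_mul_of_nonneg_left h3 hC)) (by linarith : 0 ≤ q)
    rwa [← Real.rpow_mul (Finset.sum_nonneg fun i _ =>
      Real.rpow_nonneg (signNorm_nonneg _ _) _), one_div_mul_cancel hq0, Real.rpow_one] at h4
  have hW : ∀ i, signNorm x (A π i) ^ (q - 1) * signNorm x (A π i) = signNorm x (A π i) ^ q :=
    fun i => by
      rcases (signNorm_nonneg x (A π i)).eq_or_lt with h | h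
      · rw [← h, mul_zero, Real.zero_rpow hq0]
      · rw [← Real.rpow_add_one h.ne']; ring_nf
  refine ⟨μ, fun j => ?_, ?_, fun B => ?_⟩
  · exact mul_nonneg (Real.rpow_nonneg (signNorm_nonneg _ _) _) (hν0 _ _ (by simp [A]))
  · refine le_trans (le_of_eq ?_) htot
    rw [hμsum]
    refine Finset.sum_congr rfl fun i _ => ?_
    rw [Finset.inter_univ, hν1, hW]
  · obtain ⟨i₀, hi₀⟩ : ∃ i₀, ∀ j, π j ≠ i₀ := by
      by_contra! h
      have := Fintype.card_le_of_surjective π h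
      simp at this
    -- Competitor: B is moved into the empty class. Maximality bounds the gain by the loss in the
    -- other classes, which the tangent inequality bounds by q μ(B).
    have h1 := hπ fun j => if j ∈ B then i₀ else π j
    have hA0 : A π i₀ = ∅ := by simp [A, hi₀]
    have h2 : signNorm x B ^ q + ∑ i, signNorm x (A π i \ B) ^ q ≤
        ∑ i, signNorm x (A (fun j => if j ∈ B then i₀ else π j) i) ^ q := by
      rw [← Finset.add_sum_erase _ _ (Finset.mem_univ i₀),
        ← Finset.add_sum_erase (a := i₀) (f := fun i => signNorm x (A _ i) ^ q) _ (Finset.mem_univ _),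
        hA0]
      simp only [Finset.empty_sdiff, signNorm_empty, Real.zero_rpow hq0, zero_add]
      refine add_le_add (le_of_eq ?_) (Finset.sum_le_sum fun i hi => le_of_eq ?_)
      · congr 2
        ext j
        by_cases hj : j ∈ B <;> simp [A, hj, hi₀]
      · congr 2
        ext j
        by_cases hj : j ∈ B <;> simp [A, hj, (Finset.ne_of_mem_erase hi).symm]
    have h3 : ∑ i, signNorm x (A π i) ^ q - ∑ i, signNorm x (A π i \ B) ^ q ≤
        q * ∑ j ∈ B, μ j := by
      rw [← Finset.sum_sub_distrib, hμsum, Finset.mul_sum]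
      refine Finset.sum_le_sum fun i _ => ?_
      refine (Real.rpow_sub_rpow_le hq (signNorm_nonneg _ _) (signNorm_nonneg _ _)).trans ?_
      refine mul_le_mul_of_nonneg_left (mul_le_mul_of_nonneg_left ?_
        (Real.rpow_nonneg (signNorm_nonneg _ _) _)) (by linarith)
      linarith [hν i B]
    linarith

/-- In a space of cotype `q`, weakly summable families are products of an `ℓ_{p*}` family of scalars
and a weakly `p`-summable family, `1 < p < q / (q - 1)`. -/
theorem exists_smul_weakly_summable (𝕜 : Type*) [RCLike 𝕜] {E : Type*} [NormedAddCommGroup E]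
    [NormedSpace 𝕜 E] {q p : ℝ} (hq : 1 < q) (hp : 1 < p) (hpq : p < q / (q - 1))
    (hE : HasCotype E q) :
    ∃ K : ℝ, 0 ≤ K ∧ ∀ (m : ℕ) (x : Fin m → E),
      (∀ φ : StrongDual 𝕜 E, ‖φ‖ ≤ 1 → ∑ j, ‖φ (x j)‖ ≤ 1) →
      ∃ (α : Fin m → ℝ) (y : Fin m → E), (∀ j, 0 ≤ α j) ∧ (∀ j, x j = (α j : 𝕜) • y j) ∧
        ∑ j, α j ^ (p / (p - 1)) ≤ K ∧
        ∀ φ : StrongDual 𝕜 E, ‖φ‖ ≤ 1 → ∑ j, ‖φ (y j)‖ ^ p ≤ K := by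
  classical
  obtain ⟨C, hC, hE⟩ := hE
  have hq1 : 0 < q - 1 := by linarith
  have hp1 : 0 < p - 1 := by linarith
  have hp0 : p ≠ 0 := by linarith
  set a := q / (q - 1) with ha
  set D := C ^ q with hD
  set L := (2 ^ q * q) ^ (1 / (q - 1)) with hL
  have hD0 : 0 ≤ D := by positivity
  have hL0 : 0 ≤ L := by positivity
  -- Bounds μ{|φ(x_j)|/μ_j > 2^k}: the weak-type estimate at levels at least 1, the total mass
  -- below. The series converges at the upper end because p < a.
  let v : ℤ → ℝ := fun k => if 0 ≤ k then L * ((2 : ℝ) ^ k) ^ (-a) else D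
  have hsum : Summable fun k : ℤ => ((2 : ℝ) ^ (k + 1)) ^ p * v k := by
    have h := (summable_zpow_two_rpow (a := p - a) (b := p) (by linarith) (by linarith)).mul_left
      (2 ^ p * (L + D))
    refine Summable.of_nonneg_of_le (fun k => ?_) (fun k => ?_) h
    · simp only [v]; split_ifs <;> positivity
    · rw [zpow_add_one₀ two_ne_zero, Real.mul_rpow (by positivity) zero_le_two]
      simp only [v]
      split_ifs
      · rw [sub_eq_add_neg, Real.rpow_add (by positivity)]
        have : 0 ≤ 2 ^ p * D * (((2 : ℝ) ^ k) ^ p * ((2 : ℝ) ^ k) ^ (-a)) := by positivity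
        linarith
      · have : 0 ≤ 2 ^ p * L * ((2 : ℝ) ^ k) ^ p := by positivity
        linarith
  set K := ∑' k : ℤ, ((2 : ℝ) ^ (k + 1)) ^ p * v k
  have hK : 0 ≤ K := tsum_nonneg fun k => by simp only [v]; split_ifs <;> positivity
  refine ⟨D + K, by positivity, fun m x hx => ?_⟩
  obtain ⟨μ, hμ0, hμ1, hμ⟩ := exists_weight_of_cotype 𝕜 hq.le hC hE x
  have hμD : ∑ j, μ j ≤ D := hμ1.trans <| Real.rpow_le_rpow
    (mul_nonneg hC (signNorm_nonneg _ _)) (mul_le_of_le_one_right hC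
      (signNorm_univ_le_of_sum_norm_le x hx)) (by linarith)
  have hx0 : ∀ j, μ j = 0 → x j = 0 := fun j hj => by
    have h := hμ {j}
    rw [Finset.sum_singleton, hj, mul_zero] at h
    have h0 : signNorm x {j} = 0 := by
      by_contra h0
      exact absurd h (not_le.2 (Real.rpow_pos_of_pos
        ((signNorm_nonneg x {j}).lt_of_ne' h0) q))
    exact norm_le_zero_iff.1 (h0 ▸ norm_le_signNorm_singleton x j)
  have hα0 : ∀ j, 0 ≤ μ j ^ ((p - 1) / p) := fun j => Real.rpow_nonneg (hμ0 j) _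
  -- The exponent is 1/p*, so ∑ α^(p*) is the mass of μ. Where μ vanishes so does x, and the inverse
  -- of 0 does no harm.
  refine ⟨fun j => μ j ^ ((p - 1) / p),
    fun j => (((μ j ^ ((p - 1) / p) : ℝ) : 𝕜)⁻¹) • x j, hα0, fun j => ?_, ?_, fun φ hφ => ?_⟩
  · rcases (hμ0 j).eq_or_lt with h | h
    · simp only [hx0 j h.symm, smul_zero]
    · rw [smul_inv_smul₀]
      exact RCLike.ofReal_ne_zero.2 (Real.rpow_pos_of_pos h _).ne'
  · refine le_trans (le_of_eq ?_) (hμD.trans (le_add_of_nonneg_right hK))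
    refine Finset.sum_congr rfl fun j _ => ?_
    rw [← Real.rpow_mul (hμ0 j)]
    rw [show (p - 1) / p * (p / (p - 1)) = 1 by field_simp, Real.rpow_one]
  · have hcmp : ∀ j, ‖φ ((((μ j ^ ((p - 1) / p) : ℝ) : 𝕜)⁻¹) • x j)‖ ^ p =
        μ j * (‖φ (x j)‖ / μ j) ^ p := fun j => by
      rcases (hμ0 j).eq_or_lt with h | h
      · rw [hx0 j h.symm]; simp [hp0]
      · rw [map_smul, norm_smul, norm_inv, RCLike.norm_ofReal, abs_of_nonneg (hα0 j),
          Real.mul_rpow (inv_nonneg.2 (hα0 j)) (norm_nonneg _), Real.inv_rpow (hα0 j),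
          ← Real.rpow_mul h.le, div_mul_cancel₀ _ hp0, Real.div_rpow (norm_nonneg _) h.le,
          Real.rpow_sub_one h.ne']
        field_simp
    rw [Finset.sum_congr rfl fun j _ => hcmp j]
    refine (sum_mul_le_tsum_zpow μ (fun j => ‖φ (x j)‖ / μ j) hμ0
      (fun j => div_nonneg (norm_nonneg _) (hμ0 j)) (fun t => t ^ p) (Real.zero_rpow hp0)
      (fun s hs t _ hst => Real.rpow_le_rpow hs hst (by linarith)) v (fun k => ?_) hsum).trans
      (le_add_of_nonneg_left hD0)
    set B := Finset.univ.filter fun j => (2 : ℝ) ^ k < ‖φ (x j)‖ / μ j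
    set S := ∑ j ∈ B, μ j
    have hS0 : 0 ≤ S := Finset.sum_nonneg fun j _ => hμ0 j
    have hSD : S ≤ D := (Finset.sum_le_sum_of_subset_of_nonneg (Finset.subset_univ B)
      fun j _ _ => hμ0 j).trans hμD
    simp only [v]
    split_ifs
    · have ht : (0 : ℝ) < 2 ^ k := by positivity
      set t := (2 : ℝ) ^ k
      -- Chebyshev on B; with `hμ B` it gives an inequality for S alone, t^q S^q ≤ 2^q q S, which is
      -- solved for S.
      have h1 : t * S ≤ 2 * signNorm x B := by
        refine le_trans ?_ (sum_norm_le_signNorm x B φ hφ)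
        rw [Finset.mul_sum]
        refine Finset.sum_le_sum fun j hj => ?_
        have hj := (Finset.mem_filter.1 hj).2
        rcases (hμ0 j).eq_or_lt with h | h
        · rw [← h]; simp
        · exact ((lt_div_iff₀ h).1 hj).le
      have h2 : t ^ q * S ^ q ≤ 2 ^ q * (q * S) := by
        rw [← Real.mul_rpow ht.le hS0]
        refine (Real.rpow_le_rpow (by positivity) h1 (by linarith)).trans ?_
        rw [Real.mul_rpow zero_le_two (signNorm_nonneg _ _)]
        exact mul_le_mul_of_nonneg_left (hμ B) (by positivity)
      rcases hS0.eq_or_lt with h | h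
      · rw [← h]; positivity
      · have h3 : S ^ (q - 1) ≤ 2 ^ q * q * t ^ (-q) := by
          rw [Real.rpow_sub_one h.ne', Real.rpow_neg ht.le, div_le_iff₀ h,
            mul_right_comm, ← div_eq_mul_inv, le_div_iff₀ (by positivity)]
          linarith
        have h4 := Real.rpow_le_rpow (by positivity) h3 (by positivity : 0 ≤ 1 / (q - 1))
        rw [← Real.rpow_mul hS0, mul_one_div_cancel hq1.ne', Real.rpow_one,
          Real.mul_rpow (by positivity) (by positivity), ← Real.rpow_mul ht.le] at h4
        convert h4 using 3
        rw [ha]; ring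
    · exact hSD

/-! ### Averages over signs -/

section Signs

variable {m : ℕ}

theorem sum_signs_mul (i j : Fin m) :
    ∑ ε : Fin m → ℤˣ, (((ε i : ℤˣ) : ℤ) : ℝ) * ((ε j : ℤˣ) : ℤ) = if i = j then 2 ^ m else 0 := by
  split_ifs with h
  · subst h
    have : ∀ ε : Fin m → ℤˣ, (((ε i : ℤˣ) : ℤ) : ℝ) * ((ε i : ℤˣ) : ℤ) = 1 := fun ε => by
      rcases Int.units_eq_one_or (ε i) with h | h <;> simp [h]
    simp [this]
  -- Flipping the i-th sign permutes the sign vectors and negates the sum.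
  · have h1 := Equiv.sum_comp (Equiv.mulLeft (Pi.mulSingle i (-1) : Fin m → ℤˣ))
      fun ε : Fin m → ℤˣ => (((ε i : ℤˣ) : ℤ) : ℝ) * ((ε j : ℤˣ) : ℤ)
    simp only [Equiv.coe_mulLeft, Pi.mul_apply, Pi.mulSingle_eq_same,
      Pi.mulSingle_eq_of_ne (Ne.symm h), one_mul, Units.val_neg, Int.cast_neg, neg_mul, Finset.sum_neg_distrib] at h1
    linarith

theorem sum_signs_sq (a : Fin m → ℝ) :
    ∑ ε : Fin m → ℤˣ, (∑ j, (((ε j : ℤˣ) : ℤ) : ℝ) * a j) ^ 2 = 2 ^ m * ∑ j, a j ^ 2 := by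
  simp_rw [sq, Finset.sum_mul_sum]
  rw [Finset.sum_comm, Finset.mul_sum]
  refine Finset.sum_congr rfl fun i _ => ?_
  rw [Finset.sum_comm]
  have : ∀ j, ∑ ε : Fin m → ℤˣ, (((ε i : ℤˣ) : ℤ) : ℝ) * a i * ((((ε j : ℤˣ) : ℤ) : ℝ) * a j) =
      (if i = j then 2 ^ m else 0) * (a i * a j) := fun j => by
    rw [← sum_signs_mul, Finset.sum_mul]
    exact Finset.sum_congr rfl fun ε _ => by ring
  simp [this]

variable {𝕜 : Type*} [RCLike 𝕜]

theorem sum_signs_norm_sq (c : Fin m → 𝕜) :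
    ∑ ε : Fin m → ℤˣ, ‖∑ j, ((((ε j : ℤˣ) : ℤ) : ℝ) : 𝕜) * c j‖ ^ 2 =
      2 ^ m * ∑ j, ‖c j‖ ^ 2 := by
  simp_rw [RCLike.norm_sq_eq_def, map_sum, RCLike.re_ofReal_mul, RCLike.im_ofReal_mul, ← sq,
    Finset.sum_add_distrib, sum_signs_sq, mul_add]

/-- Truncation at 1: coefficients of modulus at most 1 are handled by orthogonality and t ≤ 1 + t²,
the others by the triangle inequality. -/
theorem sum_signs_norm_le (c : Fin m → 𝕜) :
    ∑ ε : Fin m → ℤˣ, ‖∑ j, ((((ε j : ℤˣ) : ℤ) : ℝ) : 𝕜) * c j‖ ≤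
      2 ^ m * (1 + ∑ j, min ‖c j‖ (‖c j‖ ^ 2)) := by
  classical
  let u : Fin m → 𝕜 := fun j => if ‖c j‖ ≤ 1 then c j else 0
  have hpt : ∀ ε : Fin m → ℤˣ, ‖∑ j, ((((ε j : ℤˣ) : ℤ) : ℝ) : 𝕜) * c j‖ ≤
      1 + ‖∑ j, ((((ε j : ℤˣ) : ℤ) : ℝ) : 𝕜) * u j‖ ^ 2 + ∑ j, ‖c j - u j‖ := fun ε => by
    have h1 : ∑ j, ((((ε j : ℤˣ) : ℤ) : ℝ) : 𝕜) * c j =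
        ∑ j, ((((ε j : ℤˣ) : ℤ) : ℝ) : 𝕜) * u j +
          ∑ j, ((((ε j : ℤˣ) : ℤ) : ℝ) : 𝕜) * (c j - u j) := by
      rw [← Finset.sum_add_distrib]
      exact Finset.sum_congr rfl fun j _ => by ring
    rw [h1]
    refine (norm_add_le _ _).trans (add_le_add ?_ ?_)
    · nlinarith [sq_nonneg (‖∑ j, ((((ε j : ℤˣ) : ℤ) : ℝ) : 𝕜) * u j‖ - 1),
        sq_nonneg ‖∑ j, ((((ε j : ℤˣ) : ℤ) : ℝ) : 𝕜) * u j‖]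
    · refine (norm_sum_le _ _).trans (Finset.sum_le_sum fun j _ => ?_)
      rcases Int.units_eq_one_or (ε j) with h | h <;> simp [h, norm_sub_rev]
  refine (Finset.sum_le_sum fun ε _ => hpt ε).trans (le_of_eq ?_)
  rw [Finset.sum_add_distrib, Finset.sum_add_distrib, sum_signs_norm_sq]
  simp only [Finset.sum_const, Finset.card_univ, Fintype.card_pi, Fintype.card_units_int,
    Finset.prod_const, Fintype.card_fin, nsmul_eq_mul, mul_one, Nat.cast_pow, Nat.cast_ofNat]
  rw [add_assoc, ← mul_add, ← Finset.sum_add_distrib, ← mul_one_add]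
  congr 2
  refine Finset.sum_congr rfl fun j _ => ?_
  by_cases h : ‖c j‖ ≤ 1
  · simp only [u, h, if_true, sub_self, norm_zero, add_zero]
    rw [min_eq_right]; nlinarith [norm_nonneg (c j)]
  · simp only [u, h, if_false, sub_zero, norm_zero]
    rw [min_eq_left (by nlinarith [norm_nonneg (c j)])]; simp

/-- Multiplying by ε_j and averaging isolates c_j. -/
theorem norm_le_sum_signs {F : Type*} [NormedAddCommGroup F] [NormedSpace 𝕜 F] (c : Fin m → F)
    (j : Fin m) :
    2 ^ m * ‖c j‖ ≤ ∑ ε : Fin m → ℤˣ, ‖∑ i, ((((ε i : ℤˣ) : ℤ) : ℝ) : 𝕜) • c i‖ := by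
  have h1 : ∑ ε : Fin m → ℤˣ, ((((ε j : ℤˣ) : ℤ) : ℝ) : 𝕜) •
      ∑ i, ((((ε i : ℤˣ) : ℤ) : ℝ) : 𝕜) • c i = (2 ^ m : 𝕜) • c j := by
    simp_rw [Finset.smul_sum, smul_smul]
    rw [Finset.sum_comm]
    have : ∀ i, ∑ ε : Fin m → ℤˣ, (((((ε j : ℤˣ) : ℤ) : ℝ) : 𝕜) * ((((ε i : ℤˣ) : ℤ) : ℝ) : 𝕜)) • c i
        = (((if j = i then 2 ^ m else 0 : ℝ)) : 𝕜) • c i := fun i => by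
      rw [← sum_signs_mul, ← Finset.sum_smul]
      push_cast
      rfl
    rw [Finset.sum_congr rfl fun i _ => this i, Finset.sum_eq_single j]
    · simp only [if_true]; push_cast; rfl
    · intro i _ hi; simp [Ne.symm hi]
    · simp
  have h2 : ‖(2 ^ m : 𝕜) • c j‖ = 2 ^ m * ‖c j‖ := by
    rw [norm_smul, norm_pow, RCLike.norm_ofNat]
  rw [← h2, ← h1]
  refine (norm_sum_le _ _).trans (Finset.sum_le_sum fun ε _ => ?_)
  rcases Int.units_eq_one_or (ε j) with h | h <;> simp [h]

end Signs

/-! ### Discretised Pareto variables -/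

/-- The quantile function of a discretised Pareto law with exponent `p`. -/
noncomputable def pareto (p : ℝ) (N : ℕ) (i : Fin N) : ℝ :=
  ((N : ℝ) / ((i : ℕ) + 1)) ^ (1 / p)

section Pareto

variable {p : ℝ} {N : ℕ}

theorem pareto_nonneg (i : Fin N) : 0 ≤ pareto p N i := by
  unfold pareto; positivity

theorem pareto_mul_rpow (hp : p ≠ 0) (i : Fin N) {b : ℝ} (hb : 0 ≤ b) :
    (pareto p N i * b) ^ p = N * b ^ p / ((i : ℕ) + 1) := by
  rw [Real.mul_rpow (pareto_nonneg i) hb, pareto, ← Real.rpow_mul (by positivity),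
    one_div_mul_cancel hp, Real.rpow_one]
  ring

theorem card_lt_pareto_mul_le (hp : 0 < p) {b t : ℝ} (hb : 0 ≤ b) (ht : 0 < t) :
    ((Finset.univ.filter fun i : Fin N => t < pareto p N i * b).card : ℝ) ≤
      N * b ^ p * t ^ (-p) := by
  have hT : 0 ≤ N * b ^ p * t ^ (-p) := by positivity
  refine le_trans ?_ (Nat.floor_le hT)
  rw [← Finset.card_map Fin.valEmbedding]
  refine Nat.cast_le.2 ((Finset.card_le_card fun k hk => ?_).trans_eq (Finset.card_range _))
  obtain ⟨i, hi, rfl⟩ := Finset.mem_map.1 hk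
  have h1 := Real.rpow_lt_rpow ht.le (Finset.mem_filter.1 hi).2 hp
  rw [pareto_mul_rpow hp.ne' i hb, lt_div_iff₀ (by positivity)] at h1
  rw [Finset.mem_range, Fin.valEmbedding_apply, ← Nat.succ_le_iff, Nat.le_floor_iff hT,
    Real.rpow_neg ht.le, ← div_eq_mul_inv, le_div_iff₀ (by positivity)]
  push_cast
  linarith

/-- The proportion is at most 1 - b^p + 1/N, the last term being the rounding error. The exponential
form lets bounds for independent coordinates be multiplied. -/
theorem card_pareto_mul_lt_one_le (hp : 0 < p) (hN : 0 < N) {b : ℝ} (hb : 0 ≤ b) (hb1 : b ≤ 1) :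
    ((Finset.univ.filter fun i : Fin N => pareto p N i * b < 1).card : ℝ) ≤
      N * Real.exp (-b ^ p + 1 / N) := by
  have hN' : (0 : ℝ) < N := Nat.cast_pos.2 hN
  have hT : 0 ≤ N * b ^ p := by positivity
  have hTN : N * b ^ p ≤ N := mul_le_of_le_one_right hN'.le (Real.rpow_le_one hb hb1 hp.le)
  have hcard : (Finset.univ.filter fun i : Fin N => pareto p N i * b < 1).card ≤
      N - ⌊N * b ^ p⌋₊ := by
    rw [← Finset.card_map Fin.valEmbedding, ← Nat.card_Ico]
    refine Finset.card_le_card fun k hk => ?_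
    obtain ⟨i, hi, rfl⟩ := Finset.mem_map.1 hk
    have h1 := Real.rpow_lt_rpow (mul_nonneg (pareto_nonneg i) hb) (Finset.mem_filter.1 hi).2 hp
    rw [pareto_mul_rpow hp.ne' i hb, Real.one_rpow, div_lt_one (by positivity)] at h1
    rw [Finset.mem_Ico, Fin.valEmbedding_apply]
    refine ⟨Nat.lt_succ_iff.1 ((Nat.floor_lt hT).2 ?_), i.2⟩
    push_cast
    exact h1
  have hfl : ⌊N * b ^ p⌋₊ ≤ N := by
    have := Nat.floor_le_floor hTN
    rwa [Nat.floor_natCast] at this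
  calc _ ≤ ((N - ⌊N * b ^ p⌋₊ : ℕ) : ℝ) := Nat.cast_le.2 hcard
    _ = N - (⌊N * b ^ p⌋₊ : ℝ) := Nat.cast_sub hfl
    _ ≤ N - (N * b ^ p - 1) := by linarith [Nat.lt_floor_add_one (N * b ^ p)]
    _ = N * (-b ^ p + 1 / N + 1) := by field_simp; ring
    _ ≤ _ := mul_le_mul_of_nonneg_left (Real.add_one_le_exp _) hN'.le

/-- With tail t^(-p), the linear part is summable over large dyadic levels since p > 1, and the
quadratic part over small levels since p < 2. -/
theorem exists_sum_min_pareto_le (hp1 : 1 < p) (hp2 : p < 2) :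
    ∃ C : ℝ, 0 ≤ C ∧ ∀ (N : ℕ) (b : ℝ), 0 ≤ b →
      ∑ i : Fin N, min (pareto p N i * b) ((pareto p N i * b) ^ 2) ≤ N * b ^ p * C := by
  let g : ℝ → ℝ := fun t => min t (t ^ 2)
  have hgpos : ∀ t, 0 ≤ t → 0 ≤ g t := fun t ht => le_min ht (sq_nonneg t)
  have hs : Summable fun k : ℤ => g (2 ^ (k + 1)) * ((2 : ℝ) ^ k) ^ (-p) := by
    refine Summable.of_nonneg_of_le (fun k => mul_nonneg (hgpos _ (by positivity)) (by positivity))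
      (fun k => ?_)
      ((summable_zpow_two_rpow (a := 1 - p) (b := 2 - p) (by linarith) (by linarith)).mul_left 4)
    have ht : (0 : ℝ) < 2 ^ k := by positivity
    rw [zpow_add_one₀ two_ne_zero]
    split_ifs
    · rw [sub_eq_add_neg, Real.rpow_add ht, Real.rpow_one, ← mul_assoc]
      refine mul_le_mul_of_nonneg_right ((min_le_left _ _).trans ?_) (by positivity)
      linarith
    · rw [sub_eq_add_neg, Real.rpow_add ht, Real.rpow_two, ← mul_assoc]
      refine mul_le_mul_of_nonneg_right ((min_le_right _ _).trans ?_) (by positivity)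
      linarith [mul_pow ((2 : ℝ) ^ k) 2 2]
  refine ⟨∑' k : ℤ, g (2 ^ (k + 1)) * ((2 : ℝ) ^ k) ^ (-p), tsum_nonneg fun k => mul_nonneg (hgpos _ (by positivity)) (by positivity),
    fun N b hb => ?_⟩
  have h := sum_mul_le_tsum_zpow (fun _ : Fin N => (1 : ℝ)) (fun i => pareto p N i * b)
    (fun _ => zero_le_one) (fun i => mul_nonneg (pareto_nonneg i) hb) g (by simp [g])
    (fun s hs t _ hst => min_le_min hst (pow_le_pow_left₀ hs hst 2))
    (fun k => N * b ^ p * ((2 : ℝ) ^ k) ^ (-p))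
    (fun k => by
      simpa using card_lt_pareto_mul_le (N := N) (by linarith) hb (by positivity : (0 : ℝ) < 2 ^ k))
    (by simpa only [mul_left_comm] using hs.mul_left (N * b ^ p))
  simp only [one_mul, mul_left_comm _ ((N : ℝ) * b ^ p)] at h
  rwa [tsum_mul_left] at h

end Pareto

/-! ### Embedding ℓ_p into ℓ_1 -/

section Embedding

variable {𝕜 : Type*} [RCLike 𝕜] {m N : ℕ} {p : ℝ}

/-- The factor of the vector `j` in the random sum for the choices `ω.1` of values and `ω.2` of signs. -/
noncomputable def signedPareto (𝕜 : Type*) [RCLike 𝕜] (p : ℝ) (m N : ℕ)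
    (ω : (Fin m → Fin N) × (Fin m → ℤˣ)) (j : Fin m) : 𝕜 :=
  ((((ω.2 j : ℤˣ) : ℤ) : ℝ) : 𝕜) * (pareto p N (ω.1 j) : 𝕜)

theorem sum_apply_coordinate (j : Fin m) (f : Fin N → ℝ) :
    N * ∑ ω : Fin m → Fin N, f (ω j) = N ^ m * ∑ i, f i := by
  have h := Fintype.sum_piFinset_apply f Finset.univ j
  rw [Fintype.piFinset_univ, Finset.card_univ, Fintype.card_fin, Fintype.card_fin,
    nsmul_eq_mul] at h
  rw [h, ← mul_assoc, Nat.cast_pow, ← pow_succ', Nat.sub_add_cancel (Fin.pos j)]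

theorem sum_norm_signedPareto_le {C : ℝ} (hN : 0 < N)
    (hC : ∀ b : ℝ, 0 ≤ b →
      ∑ i : Fin N, min (pareto p N i * b) ((pareto p N i * b) ^ 2) ≤ N * b ^ p * C)
    (a : Fin m → 𝕜) (ha : ∑ j, ‖a j‖ ^ p = 1) :
    ∑ ω, ‖∑ j, signedPareto 𝕜 p m N ω j * a j‖ ≤ 2 ^ m * N ^ m * (1 + C) := by
  have hN' : (0 : ℝ) < N := Nat.cast_pos.2 hN
  rw [Fintype.sum_prod_type, mul_assoc]
  have h1 : ∀ ω : Fin m → Fin N, ∑ ε : Fin m → ℤˣ, ‖∑ j, signedPareto 𝕜 p m N (ω, ε) j * a j‖ ≤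
      2 ^ m * (1 + ∑ j, min (pareto p N (ω j) * ‖a j‖) ((pareto p N (ω j) * ‖a j‖) ^ 2)) :=
    fun ω => by
      have h := sum_signs_norm_le fun j => (pareto p N (ω j) : 𝕜) * a j
      simp only [norm_mul, RCLike.norm_ofReal, abs_of_nonneg (pareto_nonneg _)] at h
      simpa only [signedPareto, mul_assoc] using h
  refine (Finset.sum_le_sum fun ω _ => h1 ω).trans ?_
  rw [← Finset.mul_sum, Finset.sum_add_distrib, Finset.sum_comm]
  refine mul_le_mul_of_nonneg_left ?_ (by positivity)
  rw [mul_add]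
  refine add_le_add (by simp) ?_
  have h2 : ∀ j, ∑ ω : Fin m → Fin N,
      min (pareto p N (ω j) * ‖a j‖) ((pareto p N (ω j) * ‖a j‖) ^ 2) ≤
        N ^ m * C * ‖a j‖ ^ p := fun j => by
    refine le_of_mul_le_mul_left ?_ hN'
    rw [sum_apply_coordinate j fun i => min (pareto p N i * ‖a j‖) ((pareto p N i * ‖a j‖) ^ 2)]
    refine (mul_le_mul_of_nonneg_left (hC _ (norm_nonneg _)) (by positivity)).trans_eq ?_
    ring
  refine (Finset.sum_le_sum fun j _ => h2 j).trans_eq ?_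
  rw [← Finset.mul_sum, ha, mul_one]

/-- With probability at least 1 - e^(-1/2) some term of the random sum has norm at least 1, and
averaging over signs retains that term. -/
theorem le_sum_norm_signedPareto {F : Type*} [NormedAddCommGroup F] [NormedSpace 𝕜 F]
    (hp : 0 < p) (hN : 2 * m ≤ N) (hN0 : 0 < N) (b : Fin m → F) (hb : ∑ j, ‖b j‖ ^ p = 1) :
    2 ^ m * N ^ m * (1 - Real.exp (-(1 / 2))) ≤
      ∑ ω, ‖∑ j, signedPareto 𝕜 p m N ω j • b j‖ := by
  classical
  have hN' : (0 : ℝ) < N := Nat.cast_pos.2 hN0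
  have hb1 : ∀ j, ‖b j‖ ≤ 1 := fun j => by
    have h : ‖b j‖ ^ p ≤ 1 := hb ▸ Finset.single_le_sum (f := fun j => ‖b j‖ ^ p)
      (fun j _ => Real.rpow_nonneg (norm_nonneg _) p) (Finset.mem_univ j)
    by_contra! h1
    exact absurd h (not_le.2 (Real.one_lt_rpow h1 hp))
  -- The exceptional event that all terms are below 1 is a product set; its probability is at most
  -- exp(-∑ ‖b_j‖^p + m/N).
  set G : Finset (Fin m → Fin N) :=
    Fintype.piFinset fun j => Finset.univ.filter fun i => pareto p N i * ‖b j‖ < 1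
  have hG : (G.card : ℝ) ≤ N ^ m * Real.exp (-(1 / 2)) := by
    rw [Fintype.card_piFinset, Nat.cast_prod]
    refine (Finset.prod_le_prod (fun _ _ => Nat.cast_nonneg _) fun j _ =>
      card_pareto_mul_lt_one_le hp hN0 (norm_nonneg (b j)) (hb1 j)).trans ?_
    rw [Finset.prod_mul_distrib, ← Real.exp_sum, Finset.sum_add_distrib, Finset.sum_neg_distrib, hb]
    simp only [Finset.prod_const, Finset.card_univ, Fintype.card_fin, Finset.sum_const,
      nsmul_eq_mul]
    refine mul_le_mul_of_nonneg_left (Real.exp_le_exp.2 ?_) (by positivity)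
    have : (m : ℝ) * (1 / N) ≤ 1 / 2 := by
      rw [mul_one_div, div_le_div_iff₀ hN' two_pos]
      have : ((2 * m : ℕ) : ℝ) ≤ N := Nat.cast_le.2 hN
      push_cast at this
      linarith
    linarith
  have hGc : ∀ ω ∈ Gᶜ, (2 : ℝ) ^ m ≤
      ∑ ε : Fin m → ℤˣ, ‖∑ j, signedPareto 𝕜 p m N (ω, ε) j • b j‖ := fun ω hω => by
    obtain ⟨j, hj⟩ : ∃ j, 1 ≤ pareto p N (ω j) * ‖b j‖ := by
      simpa [G, Fintype.mem_piFinset] using hω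
    have h := norm_le_sum_signs (𝕜 := 𝕜) (fun j => (pareto p N (ω j) : 𝕜) • b j) j
    simp only [norm_smul, RCLike.norm_ofReal, abs_of_nonneg (pareto_nonneg _)] at h
    simp only [signedPareto, mul_smul]
    exact (le_mul_of_one_le_right (by positivity) hj).trans h
  rw [Fintype.sum_prod_type]
  refine le_trans ?_ (Finset.sum_le_sum_of_subset_of_nonneg (Finset.subset_univ Gᶜ)
    fun ω _ _ => Finset.sum_nonneg fun ε _ => norm_nonneg _)
  refine le_trans ?_ (Finset.card_nsmul_le_sum _ _ _ hGc)
  rw [nsmul_eq_mul, Finset.card_compl, Nat.cast_sub (Finset.card_le_univ G)]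
  simp only [Fintype.card_pi, Finset.prod_const, Finset.card_univ, Fintype.card_fin, Nat.cast_pow]
  rw [mul_comm ((2 : ℝ) ^ m), mul_right_comm]
  refine mul_le_mul_of_nonneg_right ?_ (by positivity)
  linarith

theorem exists_eq_smul_of_rpow_sum_pos {F : Type*} [NormedAddCommGroup F] [NormedSpace 𝕜 F]
    (hp : 0 < p) (b : Fin m → F) {S : ℝ} (hS : S = (∑ j, ‖b j‖ ^ p) ^ (1 / p)) :
    0 ≤ S ∧ (S = 0 → b = 0) ∧
      (0 < S → ∃ b' : Fin m → F, ∑ j, ‖b' j‖ ^ p = 1 ∧ b = fun j => (S : 𝕜) • b' j) := by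
  have h0 : 0 ≤ ∑ j, ‖b j‖ ^ p := Finset.sum_nonneg fun j _ => Real.rpow_nonneg (norm_nonneg _) _
  have hSp : S ^ p = ∑ j, ‖b j‖ ^ p := by
    rw [hS, ← Real.rpow_mul h0, one_div_mul_cancel hp.ne', Real.rpow_one]
  refine ⟨hS ▸ Real.rpow_nonneg h0 _, fun h => ?_, fun h => ?_⟩
  · rw [h, Real.zero_rpow hp.ne', eq_comm,
      Finset.sum_eq_zero_iff_of_nonneg fun j _ => Real.rpow_nonneg (norm_nonneg _) _] at hSp
    funext j
    have := (Real.rpow_eq_zero (norm_nonneg _) hp.ne').1 (hSp j (Finset.mem_univ j))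
    exact norm_eq_zero.1 this
  · refine ⟨fun j => (S : 𝕜)⁻¹ • b j, ?_, ?_⟩
    · simp_rw [norm_smul, norm_inv, RCLike.norm_ofReal, abs_of_pos h,
        Real.mul_rpow (inv_nonneg.2 h.le) (norm_nonneg _), Real.inv_rpow h.le]
      rw [← Finset.mul_sum, ← hSp, inv_mul_cancel₀ (by positivity)]
    · funext j
      rw [smul_inv_smul₀ (RCLike.ofReal_ne_zero.2 h.ne')]

/-- A finite substitute for `p`-stable variables, `1 < p < 2`: an embedding of `ℓ_p^m` into some
`ℓ_1^M` whose vector-valued extension is bounded below. -/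
theorem exists_embedding_l1 (𝕜 F : Type*) [RCLike 𝕜] [NormedAddCommGroup F] [NormedSpace 𝕜 F]
    (hp1 : 1 < p) (hp2 : p < 2) :
    ∃ C : ℝ, 0 ≤ C ∧ ∀ m : ℕ, ∃ (M : ℕ) (ψ : Fin M → Fin m → 𝕜),
      (∀ a : Fin m → 𝕜, ∑ ω, ‖∑ j, ψ ω j * a j‖ ≤ C * (∑ j, ‖a j‖ ^ p) ^ (1 / p)) ∧
      ∀ b : Fin m → F, (∑ j, ‖b j‖ ^ p) ^ (1 / p) ≤ ∑ ω, ‖∑ j, ψ ω j • b j‖ := by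
  obtain ⟨C, hC0, hC⟩ := exists_sum_min_pareto_le hp1 hp2
  have hp0 : 0 < p := by linarith
  set κ : ℝ := 1 - Real.exp (-(1 / 2)) with hκ
  have hκ0 : 0 < κ := by
    have := Real.exp_lt_exp.2 (by norm_num : (-(1 / 2) : ℝ) < 0)
    rw [Real.exp_zero] at this
    linarith
  refine ⟨(1 + C) / κ, by positivity, fun m => ?_⟩
  -- Makes the total rounding error m/N at most 1/2 and keeps N positive when m = 0.
  set N := 2 * m + 1 with hN
  have hN0 : 0 < N := by omega
  have hN' : (0 : ℝ) < N := Nat.cast_pos.2 hN0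
  set w : ℝ := 2 ^ m * N ^ m * κ with hw
  have hw0 : 0 < w := by positivity
  let e := Fintype.equivFin ((Fin m → Fin N) × (Fin m → ℤˣ))
  let Ψ := signedPareto 𝕜 p m N
  have hnw : ‖((w : 𝕜)⁻¹)‖ = w⁻¹ := by
    rw [norm_inv, RCLike.norm_ofReal, abs_of_pos hw0]
  refine ⟨_, fun i j => (w : 𝕜)⁻¹ * Ψ (e.symm i) j, fun a => ?_, fun b => ?_⟩
  · rw [Equiv.sum_comp e.symm fun ω => ‖∑ j, (w : 𝕜)⁻¹ * Ψ ω j * a j‖]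
    simp_rw [mul_assoc, ← Finset.mul_sum, norm_mul, hnw]
    rw [← Finset.mul_sum]
    obtain ⟨hS0, hSz, hSp⟩ := exists_eq_smul_of_rpow_sum_pos (𝕜 := 𝕜) hp0 a rfl
    generalize (∑ j, ‖a j‖ ^ p) ^ (1 / p) = S at hS0 hSz hSp ⊢
    rcases hS0.eq_or_lt with h | h
    · rw [hSz h.symm, ← h]; simp
    · obtain ⟨a', ha', rfl⟩ := hSp h
      simp_rw [smul_eq_mul, mul_left_comm _ (S : 𝕜), ← Finset.mul_sum, norm_mul,
        RCLike.norm_ofReal, abs_of_pos h]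
      rw [← Finset.mul_sum, mul_left_comm, mul_comm _ S]
      refine mul_le_mul_of_nonneg_left ?_ h.le
      rw [inv_mul_le_iff₀ hw0]
      refine (sum_norm_signedPareto_le hN0 (hC N) a' ha').trans_eq ?_
      rw [hw]; field_simp
  · rw [Equiv.sum_comp e.symm fun ω => ‖∑ j, ((w : 𝕜)⁻¹ * Ψ ω j) • b j‖]
    simp_rw [mul_smul, ← Finset.smul_sum, norm_smul, hnw]
    rw [← Finset.mul_sum]
    obtain ⟨hS0, hSz, hSp⟩ := exists_eq_smul_of_rpow_sum_pos (𝕜 := 𝕜) hp0 b rfl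
    generalize (∑ j, ‖b j‖ ^ p) ^ (1 / p) = S at hS0 hSz hSp ⊢
    rcases hS0.eq_or_lt with h | h
    · rw [hSz h.symm, ← h]; simp
    · obtain ⟨b', hb', rfl⟩ := hSp h
      simp_rw [smul_comm _ (S : 𝕜), ← Finset.smul_sum, norm_smul,
        RCLike.norm_ofReal, abs_of_pos h]
      rw [← Finset.mul_sum, mul_left_comm]
      refine le_mul_of_one_le_right h.le ?_
      rw [inv_mul_eq_div, one_le_div hw0]
      exact le_sum_norm_signedPareto hp0 (by omega) hN0 b' hb'

end Embedding

/-! ### Tensor products of the embeddings -/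

theorem rpow_sum_sum_rpow_le {ι κ : Type*} [Fintype ι] {p : ℝ} (hp : 1 ≤ p) (s : Finset κ)
    (g : ι → κ → ℝ) (hg : ∀ i w, 0 ≤ g i w) :
    (∑ i, (∑ w ∈ s, g i w) ^ p) ^ (1 / p) ≤ ∑ w ∈ s, (∑ i, g i w ^ p) ^ (1 / p) := by
  classical
  induction s using Finset.induction_on with
  | empty =>
    have hp0 : p ≠ 0 := by linarith
    simp [Real.zero_rpow hp0, Real.zero_rpow (inv_ne_zero hp0)]
  | insert w s hw ih =>
    simp only [Finset.sum_insert hw]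
    exact (Real.Lp_add_le_of_nonneg Finset.univ hp (fun i _ => hg i w)
      (fun i _ => Finset.sum_nonneg fun w _ => hg i w)).trans (by gcongr)

/-- Tensor products of embeddings of `ℓ_p` into `ℓ_1` that are bounded below on vector-valued families
are again bounded below. -/
theorem rpow_sum_norm_le_sum_norm_prod_smul {𝕜 F : Type*} [RCLike 𝕜] [NormedAddCommGroup F]
    [NormedSpace 𝕜 F] {p : ℝ} (hp : 1 ≤ p) {n : ℕ} (m M : Fin n → ℕ)
    (ψ : ∀ k, Fin (M k) → Fin (m k) → 𝕜)
    (hψ : ∀ k, ∀ b : Fin (m k) → F, (∑ j, ‖b j‖ ^ p) ^ (1 / p) ≤ ∑ ω, ‖∑ j, ψ k ω j • b j‖)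
    (b : (∀ k, Fin (m k)) → F) :
    (∑ j, ‖b j‖ ^ p) ^ (1 / p) ≤
      ∑ ω : (∀ k, Fin (M k)), ‖∑ j, (∏ k, ψ k (ω k) (j k)) • b j‖ := by
  have hp0 : p ≠ 0 := by linarith
  induction n with
  | zero =>
    simp only [Finset.univ_unique, Finset.sum_singleton, Finset.univ_eq_empty, Finset.prod_empty,
      one_smul]
    rw [← Real.rpow_mul (norm_nonneg _), mul_one_div_cancel hp0, Real.rpow_one]
  | succ n ih =>
    let b' : Fin (m 0) → (∀ k : Fin n, Fin (m k.succ)) → F := fun i j => b (Fin.cons i j)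
    let g : Fin (m 0) → (∀ k : Fin n, Fin (M k.succ)) → ℝ := fun i ω =>
      ‖∑ j : (∀ k : Fin n, Fin (m k.succ)), (∏ k, ψ k.succ (ω k) (j k)) • b' i j‖
    have h1 : ∀ i, ∑ j, ‖b' i j‖ ^ p ≤ (∑ ω, g i ω) ^ p := fun i => by
      have h := Real.rpow_le_rpow (Real.rpow_nonneg (Finset.sum_nonneg fun j _ =>
          Real.rpow_nonneg (norm_nonneg _) _) _)
        (ih (fun k => m k.succ) (fun k => M k.succ) (fun k => ψ k.succ) (fun k => hψ k.succ) (b' i))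
        (by linarith : 0 ≤ p)
      rwa [← Real.rpow_mul (Finset.sum_nonneg fun j _ => Real.rpow_nonneg (norm_nonneg _) _),
        one_div_mul_cancel hp0, Real.rpow_one] at h
    calc (∑ j, ‖b j‖ ^ p) ^ (1 / p)
        = (∑ i, ∑ j, ‖b' i j‖ ^ p) ^ (1 / p) := by
          rw [← Equiv.sum_comp (Fin.consEquiv fun k => Fin (m k)), Fintype.sum_prod_type]
          rfl
      _ ≤ (∑ i, (∑ ω, g i ω) ^ p) ^ (1 / p) := by
          refine Real.rpow_le_rpow (Finset.sum_nonneg fun i _ => Finset.sum_nonneg fun j _ =>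
            Real.rpow_nonneg (norm_nonneg _) _) (Finset.sum_le_sum fun i _ => h1 i) ?_
          exact one_div_nonneg.2 (by linarith)
      -- Minkowski moves the ℓ_1 sum outside, so the embedding of the first factor can be applied
      -- for each fixed ω.
      _ ≤ ∑ ω, (∑ i, g i ω ^ p) ^ (1 / p) :=
          rpow_sum_sum_rpow_le hp _ g fun i ω => norm_nonneg _
      _ ≤ ∑ ω : (∀ k : Fin n, Fin (M k.succ)), ∑ ω₀, ‖∑ i, ψ 0 ω₀ i •
            ∑ j : (∀ k : Fin n, Fin (m k.succ)), (∏ k, ψ k.succ (ω k) (j k)) • b' i j‖ :=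
          Finset.sum_le_sum fun ω _ => hψ 0 _
      _ = _ := by
          rw [Finset.sum_comm, ← Equiv.sum_comp (Fin.consEquiv fun k => Fin (M k)),
            Fintype.sum_prod_type]
          refine Finset.sum_congr rfl fun ω₀ _ => Finset.sum_congr rfl fun ω _ => ?_
          rw [← Equiv.sum_comp (Fin.consEquiv fun k => Fin (m k)), Fintype.sum_prod_type]
          congr 1
          refine Finset.sum_congr rfl fun i _ => ?_
          rw [Finset.smul_sum]
          refine Finset.sum_congr rfl fun j _ => ?_
          rw [smul_smul, Fin.prod_univ_succ]
          rfl

/-! ### Weak norms and the two inclusions -/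

section WeakNorm

variable {𝕜 : Type*} [RCLike 𝕜] {E : Type*} [NormedAddCommGroup E] [NormedSpace 𝕜 E] {p : ℝ}
  {m : ℕ} (x : Fin m → E)

theorem le_weakLpNorm (hp : 0 ≤ p) (φ : StrongDual 𝕜 E) (hφ : ‖φ‖ ≤ 1) :
    (∑ j, ‖φ (x j)‖ ^ p) ^ (1 / p) ≤ weakLpNorm 𝕜 p x :=
  le_ciSup (weakLpNorm_bddAbove 𝕜 hp x) ⟨φ, hφ⟩

theorem weakLpNorm_le {B : ℝ}
    (h : ∀ φ : StrongDual 𝕜 E, ‖φ‖ ≤ 1 → (∑ j, ‖φ (x j)‖ ^ p) ^ (1 / p) ≤ B) :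
    weakLpNorm 𝕜 p x ≤ B := by
  have : Nonempty {φ : StrongDual 𝕜 E // ‖φ‖ ≤ 1} := ⟨⟨0, by simp⟩⟩
  exact ciSup_le fun φ => h φ.1 φ.2

theorem weakLpNorm_nonneg : 0 ≤ weakLpNorm 𝕜 p x :=
  Real.iSup_nonneg fun _ => Real.rpow_nonneg
    (Finset.sum_nonneg fun _ _ => Real.rpow_nonneg (norm_nonneg _) _) _

end WeakNorm

section Inclusions

variable {𝕜 : Type*} [RCLike 𝕜] {n : ℕ} {E : Fin n → Type*} {F : Type*}
  [∀ k, NormedAddCommGroup (E k)] [∀ k, NormedSpace 𝕜 (E k)]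
  [NormedAddCommGroup F] [NormedSpace 𝕜 F] {A : ContinuousMultilinearMap 𝕜 E F} {p : ℝ}

theorem IsMultipleSumming.of_one (hp1 : 1 < p) (hp2 : p < 2)
    (hA : IsMultipleSumming 1 (fun _ => 1) A) : IsMultipleSumming p (fun _ => p) A := by
  obtain ⟨D, hD, hA⟩ := hA
  obtain ⟨C, hC, h⟩ := exists_embedding_l1 𝕜 F hp1 hp2
  refine ⟨D * C ^ n, by positivity, fun m x => ?_⟩
  choose M ψ hup hlow using fun k => h (m k)
  refine (rpow_sum_norm_le_sum_norm_prod_smul hp1.le m M ψ hlow _).trans ?_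
  have h1 := hA M fun k ω => ∑ j, ψ k ω j • x k j
  simp only [Real.rpow_one, one_div_one] at h1
  refine le_trans (le_of_eq (Finset.sum_congr rfl fun ω _ => ?_)) (h1.trans ?_)
  · rw [A.map_sum]
    simp_rw [A.map_smul_univ fun k => ψ k (ω k) (_ : Fin (m k))]
  · rw [mul_assoc]
    refine mul_le_mul_of_nonneg_left ?_ hD
    have h2 : C ^ n * ∏ k, weakLpNorm 𝕜 p (x k) = ∏ k, C * weakLpNorm 𝕜 p (x k) := by
      rw [Finset.prod_mul_distrib]; simp
    rw [h2]
    refine Finset.prod_le_prod (fun k _ => weakLpNorm_nonneg _) fun k _ =>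
      weakLpNorm_le _ fun φ hφ => ?_
    simp only [Real.rpow_one, one_div_one, map_sum, map_smul, smul_eq_mul]
    exact (hup k fun j => φ (x k j)).trans
      (mul_le_mul_of_nonneg_left (le_weakLpNorm _ (by linarith) φ hφ) hC)

/-- Homogeneity in each variable. A family of weak norm 0 cannot be normalised, but it consists of
zero vectors by Hahn–Banach. -/
theorem isMultipleSumming_one_of_unit {C : ℝ} (hC : 0 ≤ C)
    (h : ∀ (m : Fin n → ℕ) (x : ∀ k, Fin (m k) → E k),
      (∀ k, ∀ φ : StrongDual 𝕜 (E k), ‖φ‖ ≤ 1 → ∑ j, ‖φ (x k j)‖ ≤ 1) →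
      ∑ j : (∀ k, Fin (m k)), ‖A fun k => x k (j k)‖ ≤ C) :
    IsMultipleSumming 1 (fun _ => 1) A := by
  refine ⟨C, hC, fun m x => ?_⟩
  simp only [Real.rpow_one, one_div_one]
  have hle : ∀ k, ∀ φ : StrongDual 𝕜 (E k), ‖φ‖ ≤ 1 →
      ∑ j, ‖φ (x k j)‖ ≤ weakLpNorm 𝕜 1 (x k) := fun k φ hφ => by
    simpa only [Real.rpow_one, one_div_one] using le_weakLpNorm (x k) zero_le_one φ hφ
  set W : Fin n → ℝ := fun k => weakLpNorm 𝕜 1 (x k)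
  have hW0 : ∀ k, 0 ≤ W k := fun k => weakLpNorm_nonneg _
  by_cases hW : ∃ k, W k = 0
  · obtain ⟨k, hk⟩ := hW
    have hx : ∀ j, x k j = 0 := fun j => by
      obtain ⟨φ, hφ, h'⟩ := exists_dual_vector'' 𝕜 (x k j)
      have h1 := (Finset.single_le_sum (f := fun j => ‖φ (x k j)‖) (fun j _ => norm_nonneg _)
        (Finset.mem_univ j)).trans ((hle k φ hφ).trans_eq hk)
      simpa [h'] using h1
    have hz : ∀ j : (∀ k, Fin (m k)), A (fun k => x k (j k)) = 0 := fun j =>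
      A.map_coord_zero k (hx _)
    simp only [hz, norm_zero, Finset.sum_const_zero]
    exact mul_nonneg hC (Finset.prod_nonneg fun k _ => hW0 k)
  · push Not at hW
    have hWp : ∀ k, 0 < W k := fun k => (hW0 k).lt_of_ne' (hW k)
    have h1 := h m (fun k j => ((W k : 𝕜)⁻¹) • x k j) fun k φ hφ => by
      simp only [map_smul, norm_smul, norm_inv, RCLike.norm_ofReal, abs_of_pos (hWp k)]
      rw [← Finset.mul_sum, inv_mul_le_one₀ (hWp k)]
      exact hle k φ hφ
    simp_rw [A.map_smul_univ (fun k => (W k : 𝕜)⁻¹), norm_smul, norm_prod, norm_inv,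
      RCLike.norm_ofReal, abs_of_pos (hWp _)] at h1
    rw [← Finset.mul_sum, Finset.prod_inv_distrib,
      inv_mul_le_iff₀ (Finset.prod_pos fun k _ => hWp k)] at h1
    rwa [mul_comm]

theorem IsMultipleSumming.one_of_cotype {q : ℝ} (hq : 1 < q) (hE : ∀ k, HasCotype (E k) q)
    (hp1 : 1 < p) (hpq : p < q / (q - 1)) (hA : IsMultipleSumming p (fun _ => p) A) :
    IsMultipleSumming 1 (fun _ => 1) A := by
  obtain ⟨D, hD, hA⟩ := hA
  choose K hK0 hK using fun k => exists_smul_weakly_summable 𝕜 hq hp1 hpq (hE k)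
  have hp0 : 0 < p := by linarith
  have hr : (p / (p - 1)).HolderConjugate p := (Real.HolderConjugate.conjExponent hp1).symm
  set r := p / (p - 1)
  have hr0 : 0 < r := hr.pos
  refine isMultipleSumming_one_of_unit (C := (∏ k, K k) ^ (1 / r) * (D * ∏ k, K k ^ (1 / p)))
    (mul_nonneg (Real.rpow_nonneg (Finset.prod_nonneg fun k _ => hK0 k) _)
      (mul_nonneg hD (Finset.prod_nonneg fun k _ => Real.rpow_nonneg (hK0 k) _)))
    fun m x hx => ?_
  choose α y hα hxy hαK hyK using fun k => hK k (m k) (x k) (hx k)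
  have h1 : ∀ j : (∀ k, Fin (m k)), ‖A fun k => x k (j k)‖ =
      (∏ k, α k (j k)) * ‖A fun k => y k (j k)‖ := fun j => by
    simp_rw [hxy, A.map_smul_univ (fun k => (α k (j k) : 𝕜)), norm_smul, norm_prod,
      RCLike.norm_ofReal, abs_of_nonneg (hα _ _)]
  have hα' : ∀ j : (∀ k, Fin (m k)), 0 ≤ ∏ k, α k (j k) := fun j =>
    Finset.prod_nonneg fun k _ => hα k _
  simp_rw [h1]
  -- Hölder over multi-indices: the ℓ_{p*} norm of the product of the α's factorises, and the other
  -- factor is the multiple p-sum of A on the y's.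
  refine (Real.inner_le_Lp_mul_Lq_of_nonneg Finset.univ hr (fun j _ => hα' j)
    fun j _ => norm_nonneg _).trans ?_
  refine mul_le_mul (Real.rpow_le_rpow (Finset.sum_nonneg fun j _ => Real.rpow_nonneg (hα' j) _)
    ?_ (by positivity)) ((hA m y).trans (mul_le_mul_of_nonneg_left (Finset.prod_le_prod
      (fun k _ => weakLpNorm_nonneg _) fun k _ => weakLpNorm_le _ fun φ hφ => ?_) hD))
    (Real.rpow_nonneg (Finset.sum_nonneg fun j _ => Real.rpow_nonneg (norm_nonneg _) _) _)
    (Real.rpow_nonneg (Finset.prod_nonneg fun k _ => hK0 k) _)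
  · simp_rw [← Real.finsetProd_rpow _ _ fun k _ => hα k _]
    rw [← Fintype.piFinset_univ, ← Finset.prod_univ_sum (fun _ => Finset.univ)
      fun k i => α k i ^ r]
    exact Finset.prod_le_prod (fun k _ => Finset.sum_nonneg fun i _ =>
      Real.rpow_nonneg (hα k i) _) fun k _ => hαK k
  · exact Real.rpow_le_rpow (Finset.sum_nonneg fun j _ => Real.rpow_nonneg (norm_nonneg _) _)
      (hyK k φ hφ) (by positivity)

theorem isMultipleSumming_iff_one {q : ℝ} (hq : 2 < q) (hE : ∀ k, HasCotype (E k) q)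
    (hp : 1 ≤ p) (hpq : p < q / (q - 1)) :
    IsMultipleSumming p (fun _ => p) A ↔ IsMultipleSumming 1 (fun _ => 1) A := by
  rcases hp.eq_or_lt with rfl | hp
  · rfl
  · have h2 : q / (q - 1) < 2 := by
      rw [div_lt_iff₀ (by linarith)]; linarith
    exact ⟨fun h => h.one_of_cotype (by linarith) hE hp hpq, fun h => h.of_one hp (hpq.trans h2)⟩

end Inclusions

theorem mainTheorem6 {𝕜 : Type*} [RCLike 𝕜] {n : ℕ} (hn : 1 ≤ n)
    (E : Fin n → Type*) (F : Type*)
    [∀ k, NormedAddCommGroup (E k)] [∀ k, NormedSpace 𝕜 (E k)] [∀ k, CompleteSpace (E k)]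
    [NormedAddCommGroup F] [NormedSpace 𝕜 F] [CompleteSpace F]
    (q : ℝ) (hq : 2 < q) (hE : ∀ k, HasCotype (E k) q)
    (s p : ℝ) (hs : 1 ≤ s) (hsp : s ≤ p) (hp : p < q / (q - 1)) :
    multipleSumming 𝕜 E F s hs = multipleSumming 𝕜 E F p (hs.trans hsp) := by
  ext A
  exact (isMultipleSumming_iff_one hq hE hs (hsp.trans_lt hp)).trans
    (isMultipleSumming_iff_one hq hE (hs.trans hsp) hp).symm
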